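/- All graphs are finite and simple. A graph $G$ contains a graph $H$ as an immersion if there are an injective map $\phi\colon V(H)\to V(G)$ and, for every edge $uv\in E(H)$, a path $P_{uv}$ in $G$ with endpoints $\phi(u)$ and $\phi(v)$, such that the paths $P_{uv}$, $uv\in E(H)$, are pairwise edge-disjoint and no vertex of $\phi(V(H))$ is an interior vertex of any of these paths. The house graph is the graph on five vertices $v_0,\dots,v_4$ with edges $v_0v_1, v_1v_2, v_2v_3, v_3v_0, v_0v_4, v_1v_4$; a graph is house-free if it has no induced subgraph isomorphic to the house graph. Let $\alpha(G)$ denote the independence number of $G$. Theorem. Let $G$ be a house-free graph on $n$ vertices with $\alpha(G)\le 2$. Then $G$ contains the complete graph $K_{\lceil n/2\rceil}$ as an immersion. -/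

import Mathlib

/-- `G.ContainsImmersion H`: the graph `G` contains the graph `H` as an immersion. The map `φ` sends
the vertices of `H` to the branch vertices, and `P` assigns to each edge `uv` of `H` a path of `G`
between `φ u` and `φ v`; the paths for `uv` and `vu` are the same path, traversed in opposite
directions. -/
def SimpleGraph.ContainsImmersion {V W : Type*} (G : SimpleGraph V) (H : SimpleGraph W) : Prop :=
  ∃ (φ : W → V) (P : ∀ u v : W, H.Adj u v → G.Walk (φ u) (φ v)),
    Function.Injective φ ∧
    (∀ (u v : W) (h : H.Adj u v), P v u h.symm = (P u v h).reverse) ∧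
    (∀ (u v : W) (h : H.Adj u v), (P u v h).IsPath) ∧
    -- paths of distinct edges are edge-disjoint
    (∀ (u v u' v' : W) (h : H.Adj u v) (h' : H.Adj u' v'), s(u, v) ≠ s(u', v') →
      (P u v h).edges.Disjoint (P u' v' h').edges) ∧
    -- no branch vertex is an interior vertex of a path
    (∀ (u v : W) (h : H.Adj u v) (w : W), φ w ∈ (P u v h).support → φ w = φ u ∨ φ w = φ v)

/-- The house graph: the 4-cycle `0123` and a vertex `4` (the roof) adjacent to exactly
`0` and `1`. -/
def houseGraph : SimpleGraph (Fin 5) :=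
  SimpleGraph.fromEdgeSet {s(0, 1), s(1, 2), s(2, 3), s(3, 0), s(0, 4), s(1, 4)}

/-!
The complement of `G` is triangle-free and has no induced path on five vertices. Such a graph has a
homomorphism to the 5-cycle: a walk of length four can be shortened by two unless its ends are
adjacent, which gives a closed walk of length five. So a component without closed walks of length
five is bipartite, and in any other component every vertex sees both neighbours of some vertex of a
fixed 5-cycle.

Let `F₀, …, F₄` be the fibres of such a homomorphism. Distinct vertices of the same fibre, or of
fibres whose indices are not adjacent in the 5-cycle, are adjacent in `G`. Rotate so that
`|F₀| ≤ |F₁|`. If neither of the cliques `F₁ ∪ F₃` and `F₁ ∪ F₄` is large enough, take as branch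
vertices `F₀ ∪ F₂` and `min |F₃| |F₄|` vertices of `F₄`. Assign to each branch vertex `a ∈ F₀` its
own `d ∈ F₁` and to each branch vertex `x ∈ F₄` its own `e ∈ F₃`. A missing edge `xa` is replaced
by the path `x d e a`.
-/

section

open SimpleGraph Finset

variable {V W U : Type*} {G : SimpleGraph V} {H : SimpleGraph W}

/-! ### Immersions -/

-- Edge-disjointness is automatic: the image of an edge under `r` tells which path it belongs to.
theorem containsImmersion_of_retraction (φ : W → V) (hφ : φ.Injective) (r : V → V)
    (hr : ∀ w, r (φ w) = φ w)
    (hpath : ∀ u v, H.Adj u v →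
      ∃ p : G.Walk (φ u) (φ v), ∀ e ∈ p.edges, e.map r = s(φ u, φ v)) :
    G.ContainsImmersion H := by
  classical
  choose p hp using hpath
  obtain ⟨_, -⟩ := exists_wellFoundedLT W
  let P (u v : W) (h : H.Adj u v) : G.Walk (φ u) (φ v) :=
    if u < v then (p u v h).bypass else (p v u h.symm).bypass.reverse
  have map_edge (u v h) : ∀ e ∈ (P u v h).edges, e.map r = s(φ u, φ v) := by
    intro e he
    by_cases huv : u < v
    · simp only [P, if_pos huv] at he
      exact hp u v h e (Walk.edges_bypass_subset_edges _ he)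
    · simp only [P, if_neg huv, Walk.edges_reverse, List.mem_reverse] at he
      rw [hp v u h.symm e (Walk.edges_bypass_subset_edges _ he), Sym2.eq_swap]
  refine ⟨φ, P, hφ, fun u v h => ?_, fun u v h => ?_, fun u v u' v' h h' hne e he he' => ?_,
    fun u v h w hw => ?_⟩
  · rcases h.ne.lt_or_gt with huv | huv <;> simp [P, huv, huv.not_gt]
  · by_cases huv : u < v
    · simpa only [P, if_pos huv] using Walk.bypass_isPath _
    · simpa only [P, if_neg huv] using (Walk.bypass_isPath _).reverse
  · apply hne
    apply Sym2.map.injective hφ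
    rw [Sym2.map_mk, Sym2.map_mk, ← map_edge u v h e he, ← map_edge u' v' h' e he']
  · have not_nil : ¬ (P u v h).Nil := Walk.not_nil_of_ne (hφ.ne h.ne)
    obtain ⟨e, he, hwe⟩ := (Walk.mem_support_iff_exists_mem_edges_of_not_nil not_nil).mp hw
    have hmem : r (φ w) ∈ e.map r := Sym2.mem_map.mpr ⟨_, hwe, rfl⟩
    rwa [map_edge u v h e he, hr, Sym2.mem_iff] at hmem

theorem containsImmersion_of_isContained {K : SimpleGraph U} (hG : G.ContainsImmersion H)
    (hK : K ⊑ H) : G.ContainsImmersion K := by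
  obtain ⟨φ, P, hφ, hsymm, hpath, hdisj, hbranch⟩ := hG
  obtain ⟨f⟩ := hK
  exact ⟨φ ∘ f, fun u v h => P (f u) (f v) (f.toHom.map_adj h), hφ.comp f.injective,
    fun u v h => hsymm _ _ _, fun u v h => hpath _ _ _,
    fun u v u' v' h h' hne => hdisj _ _ _ _ _ _ fun heq =>
      hne (Sym2.map.injective f.injective heq),
    fun u v h w => hbranch _ _ _ (f w)⟩

theorem containsImmersion_completeGraph_fin {S : Finset V} {m : ℕ}
    (hS : G.ContainsImmersion (completeGraph (S : Set V))) (hm : m ≤ #S) :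
    G.ContainsImmersion (completeGraph (Fin m)) :=
  containsImmersion_of_isContained hS <| isContained_top_iff.mpr <|
    Function.Embedding.nonempty_of_card_le (by simpa using hm)

theorem containsImmersion_completeGraph_of_isClique {S : Set V} (hS : G.IsClique S) :
    G.ContainsImmersion (completeGraph S) :=
  containsImmersion_of_retraction Subtype.val Subtype.val_injective id (fun _ => rfl)
    fun u v huv => ⟨(hS u.2 v.2 (Subtype.val_injective.ne huv.ne)).toWalk, by simp⟩

/-! ### Graphs whose complement maps to the 5-cycle -/

theorem adj_of_not_adj_map (f : Gᶜ →g H) {u v : V} (huv : u ≠ v) (hf : ¬ H.Adj (f u) (f v)) :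
    G.Adj u v := by
  by_contra h
  exact hf (f.map_adj ((G.compl_adj u v).mpr ⟨huv, h⟩))

theorem isClique_preimage (f : Gᶜ →g H) {s : Set W} (hs : H.IsIndepSet s) :
    G.IsClique (f ⁻¹' s) := fun _ hu _ hv huv =>
  adj_of_not_adj_map f huv fun h => hs hu hv h.ne h

theorem exists_walk_map_edges_eq (f : Gᶜ →g cycleGraph 5) {r : V → V} {x a : V}
    (hfx : f x = 4) (hfa : f a = 0) (hrx : r x = x) (hra : r a = a)
    (hx : x ∈ r '' (f ⁻¹' {3})) (ha : a ∈ r '' (f ⁻¹' {1})) :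
    ∃ p : G.Walk x a, ∀ e ∈ p.edges, e.map r = s(x, a) := by
  obtain ⟨d, hfd : f d = 1, hrd⟩ := ha
  obtain ⟨e, hfe : f e = 3, hre⟩ := hx
  have adj {u v : V} (h : f u ≠ f v ∧ ¬ (cycleGraph 5).Adj (f u) (f v)) : G.Adj u v :=
    adj_of_not_adj_map f (fun huv => h.1 (congrArg f huv)) h.2
  have hxd : G.Adj x d := adj (by rw [hfx, hfd]; decide)
  have hde : G.Adj d e := adj (by rw [hfd, hfe]; decide)
  have hea : G.Adj e a := adj (by rw [hfe, hfa]; decide)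
  exact ⟨.cons hxd (.cons hde hea.toWalk), by simp [hrx, hra, hrd, hre, Sym2.eq_swap]⟩

theorem containsImmersion_of_surjOn (f : Gᶜ →g cycleGraph 5) {S : Set V} {r : V → V}
    (hS : ∀ v ∈ S, f v = 0 ∨ f v = 2 ∨ f v = 4) (hr : ∀ v ∈ S, r v = v)
    (h₁₀ : Set.SurjOn r (f ⁻¹' {1}) (S ∩ f ⁻¹' {0}))
    (h₃₄ : Set.SurjOn r (f ⁻¹' {3}) (S ∩ f ⁻¹' {4})) :
    G.ContainsImmersion (completeGraph S) := by
  have detour {x a : V} (hx : x ∈ S) (ha : a ∈ S) (hfx : f x = 4) (hfa : f a = 0) :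
      ∃ p : G.Walk x a, ∀ e ∈ p.edges, e.map r = s(x, a) :=
    exists_walk_map_edges_eq f hfx hfa (hr x hx) (hr a ha) (h₃₄ ⟨hx, hfx⟩) (h₁₀ ⟨ha, hfa⟩)
  refine containsImmersion_of_retraction Subtype.val Subtype.val_injective r
    (fun v => hr v v.2) fun ⟨u, hu⟩ ⟨v, hv⟩ huv => ?_
  by_cases hadj : G.Adj u v
  · exact ⟨hadj.toWalk, by simp [hr u hu, hr v hv]⟩
  have hfuv : (cycleGraph 5).Adj (f u) (f v) := by
    by_contra h
    exact hadj (adj_of_not_adj_map f (fun huv' => huv.ne (Subtype.ext huv')) h)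
  have hends : ∀ i j : Fin 5, i = 0 ∨ i = 2 ∨ i = 4 → j = 0 ∨ j = 2 ∨ j = 4 →
    (cycleGraph 5).Adj i j → i = 4 ∧ j = 0 ∨ j = 4 ∧ i = 0 := by decide
  rcases hends _ _ (hS u hu) (hS v hv) hfuv with ⟨hfu, hfv⟩ | ⟨hfv, hfu⟩
  · exact detour hu hv hfu hfv
  · obtain ⟨p, hp⟩ := detour hv hu hfv hfu
    exact ⟨p.reverse, fun e he => by rw [hp e (by simpa using he), Sym2.eq_swap]⟩

theorem exists_surjOn_of_card_le {s t : Finset V} (h : #t ≤ #s) :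
    ∃ r : V → V, Set.SurjOn r s t := by
  obtain ⟨e⟩ : Nonempty (t ↪ s) := Function.Embedding.nonempty_of_card_le (by simpa using h)
  refine ⟨Function.extend (fun y => (e y : V)) Subtype.val id, fun y hy => ?_⟩
  exact ⟨e ⟨y, hy⟩, (e _).2, (Subtype.val_injective.comp e.injective).extend_apply _ _ ⟨y, hy⟩⟩

theorem exists_hom_cycleGraph_card_fiber_zero_le_one [Fintype V] {n : ℕ}
    (f : G →g cycleGraph (n + 1)) :
    ∃ g : G →g cycleGraph (n + 1), #{v | g v = 0} ≤ #{v | g v = 1} := by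
  obtain ⟨j, -, hj⟩ := exists_min_image univ (fun i => #{v | f v = i}) univ_nonempty
  let rotation : cycleGraph (n + 1) →g cycleGraph (n + 1) :=
    ⟨(· - j), fun {a b} h => by
      simpa only [cycleGraph_eq_circulantGraph, sub_eq_add_neg, circulantGraph_adj_translate]
        using h⟩
  refine ⟨rotation.comp f, ?_⟩
  simpa [rotation, sub_eq_zero, sub_eq_iff_eq_add'] using hj (j + 1) (mem_univ _)

theorem card_filter_eq_or_eq [Fintype V] [DecidableEq W] (f : V → W) {i j : W} (hij : i ≠ j) :
    #{v | f v = i ∨ f v = j} = #{v | f v = i} + #{v | f v = j} := by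
  classical
  rw [filter_or, card_union_of_disjoint]
  exact disjoint_filter.mpr fun v _ hi hj => hij (hi.symm.trans hj)

theorem containsImmersion_completeGraph_of_card_fiber_le [Fintype V] (f : Gᶜ →g cycleGraph 5)
    {x m : ℕ} (h₀₁ : #{v | f v = 0} ≤ #{v | f v = 1}) (hx₃ : x ≤ #{v | f v = 3})
    (hx₄ : x ≤ #{v | f v = 4}) (hm : m ≤ #{v | f v = 0} + #{v | f v = 2} + x) :
    G.ContainsImmersion (completeGraph (Fin m)) := by
  classical
  obtain ⟨X, hX, rfl⟩ := exists_subset_card_eq hx₄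
  have hfX : ∀ v ∈ X, f v = 4 := fun v hv => by simpa using hX hv
  obtain ⟨q, hq⟩ := exists_surjOn_of_card_le h₀₁
  obtain ⟨t, ht⟩ := exists_surjOn_of_card_le hx₃
  let S := ({v | f v = 0 ∨ f v = 2} : Finset V) ∪ X
  let r (v : V) : V := if f v = 1 then q v else if f v = 3 then t v else v
  have hS : ∀ v ∈ S, f v = 0 ∨ f v = 2 ∨ f v = 4 := by
    intro v hv
    simp only [S, mem_union, mem_filter_univ] at hv
    exact or_assoc.mp (hv.imp_right (hfX v))
  have hr : ∀ v ∈ S, r v = v := by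
    intro v hv
    rcases hS v hv with h | h | h <;> simp [r, h]
  have h₁₀ : Set.SurjOn r (f ⁻¹' {1}) (S ∩ f ⁻¹' {0}) := by
    rintro v ⟨-, hv⟩
    obtain ⟨d, hd, rfl⟩ := hq (by simpa using hv)
    have hfd : f d = 1 := by simpa using hd
    exact ⟨d, hfd, by simp [r, hfd]⟩
  have h₃₄ : Set.SurjOn r (f ⁻¹' {3}) (S ∩ f ⁻¹' {4}) := by
    rintro v ⟨hvS, hv : f v = 4⟩
    obtain ⟨e, he, rfl⟩ := ht (show v ∈ (X : Set V) by simpa [S, hv] using hvS)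
    have hfe : f e = 3 := by simpa using he
    exact ⟨e, hfe, by simp [r, hfe]⟩
  have hdisj : Disjoint ({v | f v = 0 ∨ f v = 2} : Finset V) X :=
    disjoint_left.mpr fun v hv hvX => by simp [hfX v hvX] at hv
  have hcard : m ≤ #S := by
    rwa [card_union_of_disjoint hdisj, card_filter_eq_or_eq f (by decide)]
  exact containsImmersion_completeGraph_fin (containsImmersion_of_surjOn f hS hr h₁₀ h₃₄) hcard

theorem containsImmersion_completeGraph_of_le_card_fiber_add [Fintype V] [DecidableEq W]
    (f : Gᶜ →g H) {i j : W} (hij : i ≠ j) (hadj : ¬ H.Adj i j) {m : ℕ}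
    (hm : m ≤ #{v | f v = i} + #{v | f v = j}) :
    G.ContainsImmersion (completeGraph (Fin m)) := by
  have hindep : H.IsIndepSet {i, j} :=
    Set.pairwise_pair.mpr fun _ => ⟨hadj, fun h => hadj h.symm⟩
  have hclique : G.IsClique ({v | f v = i ∨ f v = j} : Finset V) :=
    (isClique_preimage f hindep).subset (by intro; simp)
  exact containsImmersion_completeGraph_fin
    (containsImmersion_completeGraph_of_isClique hclique)
    (by rwa [← card_filter_eq_or_eq f hij] at hm)

theorem containsImmersion_completeGraph_of_hom_cycleGraph_five [Fintype V]
    (f : Gᶜ →g cycleGraph 5) {m : ℕ} (hm : 2 * m ≤ Fintype.card V + 1) :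
    G.ContainsImmersion (completeGraph (Fin m)) := by
  obtain ⟨f, h₀₁⟩ := exists_hom_cycleGraph_card_fiber_zero_le_one f
  have hcard : Fintype.card V =
      #{v | f v = 0} + #{v | f v = 1} + #{v | f v = 2} + #{v | f v = 3} + #{v | f v = 4} := by
    rw [← card_univ, card_eq_sum_card_fiberwise (t := univ) (f := f) (by simp),
      Fin.sum_univ_five]
  by_cases h₁₃ : m ≤ #{v | f v = 1} + #{v | f v = 3}
  · exact containsImmersion_completeGraph_of_le_card_fiber_add f (by decide) (by decide) h₁₃
  by_cases h₁₄ : m ≤ #{v | f v = 1} + #{v | f v = 4}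
  · exact containsImmersion_completeGraph_of_le_card_fiber_add f (by decide) (by decide) h₁₄
  exact containsImmersion_completeGraph_of_card_fiber_le f
    (x := min #{v | f v = 3} #{v | f v = 4}) h₀₁ (min_le_left _ _) (min_le_right _ _) (by omega)

/-! ### Triangle-free graphs without an induced path on five vertices -/

theorem not_adj_of_cliqueFree_three (hK : G.CliqueFree 3) {u v w : V} (hu : G.Adj u w)
    (hv : G.Adj v w) : ¬ G.Adj u v := fun huv =>
  isIndepSet_neighborSet_of_triangleFree G hK w hu.symm hv.symm huv.ne huv

theorem adj_of_walk_length_four (hK : G.CliqueFree 3) (hP : ¬ pathGraph 5 ⊴ G) {a b c d e : V}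
    (hab : G.Adj a b) (hbc : G.Adj b c) (hcd : G.Adj c d) (hde : G.Adj d e) :
    G.Adj a d ∨ G.Adj b e ∨ G.Adj a e := by
  by_contra! ⟨had, hbe, hae⟩
  have hac : ¬ G.Adj a c := not_adj_of_cliqueFree_three hK hab hbc.symm
  have hbd : ¬ G.Adj b d := not_adj_of_cliqueFree_three hK hbc hcd.symm
  have hce : ¬ G.Adj c e := not_adj_of_cliqueFree_three hK hcd hde.symm
  have hne : a ≠ c ∧ a ≠ d ∧ a ≠ e ∧ b ≠ d ∧ b ≠ e ∧ c ≠ e := by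
    refine ⟨?_, ?_, ?_, ?_, ?_, ?_⟩ <;> rintro rfl <;> simp_all [G.adj_comm]
  obtain ⟨nac, nad, nae, nbd, nbe, nce⟩ := hne
  refine hP ⟨⟨⟨![a, b, c, d, e], ?_⟩, fun {i j} => ?_⟩⟩
  · intro i j hij
    fin_cases i <;> fin_cases j <;> simp_all [eq_comm]
  · change G.Adj (![a, b, c, d, e] i) (![a, b, c, d, e] j) ↔ _
    fin_cases i <;> fin_cases j <;> simp_all [pathGraph_adj, G.adj_comm]

theorem nonempty_cycleGraph_five_hom_of_adj {a b c d e : V} (hab : G.Adj a b) (hbc : G.Adj b c)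
    (hcd : G.Adj c d) (hde : G.Adj d e) (hae : G.Adj a e) : Nonempty (cycleGraph 5 →g G) := by
  refine ⟨⟨![a, b, c, d, e], fun {i j} hij => ?_⟩⟩
  fin_cases i <;> fin_cases j <;>
    first | exact absurd hij (by decide) | simp_all [G.adj_comm]

theorem exists_walk_length_le_three (hK : G.CliqueFree 3) (hP : ¬ pathGraph 5 ⊴ G)
    (hC : IsEmpty (cycleGraph 5 →g G)) {u v : V} (p : G.Walk u v) :
    ∃ q : G.Walk u v, q.length ≤ 3 ∧ (Even q.length ↔ Even p.length) := by
  induction p with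
  | nil => exact ⟨.nil, by simp, Iff.rfl⟩
  | cons h p ih =>
    obtain ⟨q, hq, hpar⟩ := ih
    rcases hq.lt_or_eq with hlt | heq
    · exact ⟨.cons h q, by simpa using hlt, by simp [Nat.even_add_one, hpar]⟩
    have hodd : ¬ Even p.length := hpar.not.mp (heq ▸ by decide)
    match q, heq with
    | .cons hbc (.cons hcd (.cons hde .nil)), _ =>
      rcases adj_of_walk_length_four hK hP h hbc hcd hde with had | hbe | hae
      · exact ⟨.cons had hde.toWalk, by simp, by simp [Nat.even_add_one, hodd]⟩
      · exact ⟨.cons h hbe.toWalk, by simp, by simp [Nat.even_add_one, hodd]⟩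
      · exact (not_nonempty_iff.mpr hC (nonempty_cycleGraph_five_hom_of_adj h hbc hcd hde hae)).elim

theorem colorable_two_of_isEmpty_hom_cycleGraph_five (hK : G.CliqueFree 3)
    (hP : ¬ pathGraph 5 ⊴ G) (hC : IsEmpty (cycleGraph 5 →g G)) : G.Colorable 2 := by
  refine two_colorable_iff_forall_loop_even.mpr fun u p => ?_
  obtain ⟨q, hq, hpar⟩ := exists_walk_length_le_three hK hP hC p
  rw [← hpar]
  match q, hq with
  | .nil, _ => simp
  | .cons h .nil, _ => exact (h.ne rfl).elim
  | .cons _ (.cons _ .nil), _ => simp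
  | .cons huv (.cons hvw (.cons hwu .nil)), _ =>
    exact (not_adj_of_cliqueFree_three hK huv.symm hwu hvw).elim

theorem nonempty_hom_of_colorable_two (hG : G.Colorable 2) {a b : W} (hab : H.Adj a b) :
    Nonempty (G →g H) := by
  obtain ⟨f⟩ := hG
  refine ⟨Hom.comp ⟨![a, b], fun {i j} hij => ?_⟩ f⟩
  fin_cases i <;> fin_cases j <;> simp_all [hab.symm]

/-- The vertex `v` is attached to the copy `c` of `H` in `G` if it sees the images of all neighbours
of some vertex `i` of `H`, so that it could take the place of `c i`. -/
def IsAttached (c : H →g G) (v : V) : Prop :=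
  ∃ i, ∀ k, H.Adj i k → G.Adj v (c k)

theorem isAttached_map (c : H →g G) (i : W) : IsAttached c (c i) :=
  ⟨i, fun _ hk => c.map_adj hk⟩

theorem cycleGraph_five_adj_add_one : ∀ i : Fin 5, (cycleGraph 5).Adj i (i + 1) ∧
    (cycleGraph 5).Adj (i + 1) (i + 2) ∧ (cycleGraph 5).Adj (i + 2) (i + 3) ∧
    (cycleGraph 5).Adj (i + 3) (i + 4) ∧ (cycleGraph 5).Adj (i + 4) i := by
  decide

theorem isAttached_of_adj_map (hK : G.CliqueFree 3) (hP : ¬ pathGraph 5 ⊴ G)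
    (c : cycleGraph 5 →g G) {v : V} {i : Fin 5} (hv : G.Adj v (c i)) : IsAttached c v := by
  obtain ⟨h₀₁, h₁₂, h₂₃, h₃₄, h₄₀⟩ := cycleGraph_five_adj_add_one i
  rcases adj_of_walk_length_four hK hP hv (c.map_adj h₀₁) (c.map_adj h₁₂) (c.map_adj h₂₃) with
    hv₂ | h₀₃ | hv₃
  · have neighbors : ∀ i k : Fin 5, (cycleGraph 5).Adj (i + 1) k → k = i ∨ k = i + 2 := by decide
    refine ⟨i + 1, fun k hk => ?_⟩
    rcases neighbors i k hk with rfl | rfl <;> assumption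
  · exact (not_adj_of_cliqueFree_three hK (c.map_adj h₄₀.symm) (c.map_adj h₃₄) h₀₃).elim
  · have neighbors : ∀ i k : Fin 5, (cycleGraph 5).Adj (i + 4) k → k = i ∨ k = i + 3 := by decide
    refine ⟨i + 4, fun k hk => ?_⟩
    rcases neighbors i k hk with rfl | rfl <;> assumption

theorem IsAttached.of_adj (hK : G.CliqueFree 3) (hP : ¬ pathGraph 5 ⊴ G)
    {c : cycleGraph 5 →g G} {u v : V} (hu : IsAttached c u) (huv : G.Adj u v) :
    IsAttached c v := by
  obtain ⟨i, hi⟩ := hu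
  obtain ⟨h₀₁, h₁₂, h₂₃, h₃₄, h₄₀⟩ := cycleGraph_five_adj_add_one i
  rcases adj_of_walk_length_four hK hP huv.symm (hi _ h₀₁) (c.map_adj h₁₂) (c.map_adj h₂₃) with
    hv₂ | hu₃ | hv₃
  · exact isAttached_of_adj_map hK hP c hv₂
  · exact (not_adj_of_cliqueFree_three hK (hi _ h₄₀.symm) (c.map_adj h₃₄) hu₃).elim
  · exact isAttached_of_adj_map hK hP c hv₃

theorem IsAttached.of_reachable (hK : G.CliqueFree 3) (hP : ¬ pathGraph 5 ⊴ G)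
    {c : cycleGraph 5 →g G} {u v : V} (hu : IsAttached c u) (huv : G.Reachable u v) :
    IsAttached c v := by
  obtain ⟨p⟩ := huv
  induction p with
  | nil => exact hu
  | cons h _ ih => exact ih (hu.of_adj hK hP h)

theorem nonempty_hom_of_forall_isAttached (hK : G.CliqueFree 3) (c : H →g G)
    (hH : ∀ i j, ¬ H.Adj i j → ∃ k, H.Adj i k ∧ H.Adj j k) (hc : ∀ v, IsAttached c v) :
    Nonempty (G →g H) := by
  choose f hf using hc
  refine ⟨⟨f, fun {u v} huv => ?_⟩⟩
  by_contra h
  obtain ⟨k, hik, hjk⟩ := hH _ _ h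
  exact not_adj_of_cliqueFree_three hK (hf u k hik) (hf v k hjk) huv

theorem nonempty_hom_cycleGraph_five_of_preconnected (hG : G.Preconnected)
    (hK : G.CliqueFree 3) (hP : ¬ pathGraph 5 ⊴ G) : Nonempty (G →g cycleGraph 5) := by
  rcases isEmpty_or_nonempty (cycleGraph 5 →g G) with hC | ⟨⟨c⟩⟩
  · exact nonempty_hom_of_colorable_two (colorable_two_of_isEmpty_hom_cycleGraph_five hK hP hC)
      (show (cycleGraph 5).Adj 0 1 by decide)
  · exact nonempty_hom_of_forall_isAttached hK c (by decide) fun v =>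
      (isAttached_map c 0).of_reachable hK hP (hG (c 0) v)

theorem nonempty_hom_cycleGraph_five_of_cliqueFree (hK : G.CliqueFree 3)
    (hP : ¬ pathGraph 5 ⊴ G) : Nonempty (G →g cycleGraph 5) := by
  have on_component (C : G.ConnectedComponent) : Nonempty (C.toSimpleGraph →g cycleGraph 5) :=
    have hind : C.toSimpleGraph ⊴ G := (Embedding.induce C.supp).isIndContained
    nonempty_hom_cycleGraph_five_of_preconnected C.connected_toSimpleGraph.preconnected
      (hK.comap hind.isContained) fun h => hP (h.trans hind)
  exact ⟨G.homOfConnectedComponents fun C => (on_component C).some⟩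

theorem compl_houseGraph_isIndContained_pathGraph : houseGraphᶜ ⊴ pathGraph 5 := by
  refine ⟨⟨⟨![0, 4, 1, 3, 2], by decide⟩, fun {i j} => ?_⟩⟩
  change (pathGraph 5).Adj (![0, 4, 1, 3, 2] i) (![0, 4, 1, 3, 2] j) ↔ _
  fin_cases i <;> fin_cases j <;> simp [houseGraph, pathGraph_adj]

theorem indepSetFree_of_indepNum_lt [Finite V] {n : ℕ} (h : G.indepNum < n) :
    G.IndepSetFree n := fun _ hs =>
  h.not_ge (hs.card_eq ▸ hs.isIndepSet.card_le_indepNum)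

end

theorem mainTheorem5 {V : Type*} [Fintype V] (G : SimpleGraph V)
    (hhouse : ¬ houseGraph.IsIndContained G) (hα : G.indepNum ≤ 2) :
    G.ContainsImmersion (SimpleGraph.completeGraph (Fin ⌈(Fintype.card V : ℚ) / 2⌉₊)) := by
  have hK : Gᶜ.CliqueFree 3 :=
    (SimpleGraph.cliqueFree_compl G).mpr (indepSetFree_of_indepNum_lt (by omega))
  have hP : ¬ (SimpleGraph.pathGraph 5).IsIndContained Gᶜ := fun h =>
    hhouse (compl_houseGraph_isIndContained_pathGraph.trans h).of_compl
  obtain ⟨f⟩ := nonempty_hom_cycleGraph_five_of_cliqueFree hK hP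
  refine containsImmersion_completeGraph_of_hom_cycleGraph_five f ?_
  have hceil : (⌈(Fintype.card V : ℚ) / 2⌉₊ : ℚ) < Fintype.card V / 2 + 1 :=
    Nat.ceil_lt_add_one (by positivity)
  have : (2 * ⌈(Fintype.card V : ℚ) / 2⌉₊ : ℚ) < Fintype.card V + 2 := by linarith
  have : 2 * ⌈(Fintype.card V : ℚ) / 2⌉₊ < Fintype.card V + 2 := by exact_mod_cast this
  omega
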